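/- Let $M$ be a smooth $n$-dimensional manifold (Hausdorff, second countable, without boundary), let $g$ be a smooth pseudo-Riemannian metric on $M$ with Levi-Civita connection $\nabla$ (the torsion-free connection with $\nabla g=0$), and let $\mathcal D\subset TM$ be a smooth distribution of rank $r\le n/2$ that is parallel ($\nabla_XY\in\Gamma(\mathcal D)$ for all $X\in\Gamma(TM)$, $Y\in\Gamma(\mathcal D)$) and totally isotropic ($g(Y,Z)=0$ for all $Y,Z\in\Gamma(\mathcal D)$); that is, $(M,g)$ is a Walker manifold of rank $r$ with null parallel distribution $\mathcal D$. Then $\mathcal D$ is involutive: $[X,Y]\in\Gamma(\mathcal D)$ for all $X,Y\in\Gamma(\mathcal D)$. Moreover $\mathcal D$ integrates to a foliation of dimension $r$: there is a unique $r$-dimensional smooth foliation $\mathcal F_{\mathcal D}$ of $M$ (the Walker foliation) whose tangent distribution is $\mathcal D$. Here an $r$-dimensional foliation is a maximal family of smooth charts that covers $M$ and whose transition maps are locally of the form $(x,y)\mapsto(h_1(x,y),h_2(y))$ with $x\in\mathbb R^r$, $y\in\mathbb R^{n-r}$, and its tangent distribution is given in each such chart by $\ker dy^1\cap\dots\cap\ker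 dy^{n-r}$. -/

import Mathlib

open scoped Manifold ContDiff Bundle

noncomputable section

/-- A smooth vector field on the `n`-manifold `M`, i.e. membership in `Γ(TM)`. -/
def IsSmoothVectorField {n : ℕ} {M : Type*} [TopologicalSpace M]
    [ChartedSpace (EuclideanSpace ℝ (Fin n)) M] [IsManifold (𝓡 n) ∞ M]
    (X : Π x : M, TangentSpace (𝓡 n) x) : Prop :=
  ContMDiff (𝓡 n) ((𝓡 n).prod 𝓘(ℝ, EuclideanSpace ℝ (Fin n))) ∞
    (fun x ↦ (⟨x, X x⟩ : TangentBundle (𝓡 n) M))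

/-- A smooth pseudo-Riemannian metric of signature `(p, q)` on an `n`-manifold: a smooth
symmetric non-degenerate `(0,2)`-tensor field with `p` minus signs and `q` plus signs at every
point (so that `p + q = n`, by non-degeneracy). -/
structure PseudoRiemannianMetric (p q n : ℕ) (M : Type*) [TopologicalSpace M]
    [ChartedSpace (EuclideanSpace ℝ (Fin n)) M] [IsManifold (𝓡 n) ∞ M] where
  /-- The scalar product on each tangent space. -/
  val : ∀ x : M, TangentSpace (𝓡 n) x →L[ℝ] TangentSpace (𝓡 n) x →L[ℝ] ℝ
  symm : ∀ (x : M) (v w : TangentSpace (𝓡 n) x), val x v w = val x w v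
  nondegenerate : ∀ (x : M) (v : TangentSpace (𝓡 n) x), (∀ w, val x v w = 0) → v = 0
  sigNeg_eq : ∀ x : M,
    sigNeg (LinearMap.BilinMap.toQuadraticMap (val x).toLinearMap₁₂) = p
  sigPos_eq : ∀ x : M,
    sigPos (LinearMap.BilinMap.toQuadraticMap (val x).toLinearMap₁₂) = q
  contMDiff : ContMDiff (𝓡 n)
    ((𝓡 n).prod 𝓘(ℝ, EuclideanSpace ℝ (Fin n) →L[ℝ] EuclideanSpace ℝ (Fin n) →L[ℝ] ℝ)) ∞
    (fun x ↦ Bundle.TotalSpace.mk' (EuclideanSpace ℝ (Fin n) →L[ℝ] EuclideanSpace ℝ (Fin n) →L[ℝ] ℝ)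
      (E := fun x : M ↦ TangentSpace (𝓡 n) x →L[ℝ] TangentSpace (𝓡 n) x →L[ℝ] ℝ) x (val x))

/-- `nabla` is the Levi-Civita connection of `g`: it is torsion-free and `∇g = 0`, i.e.
`X (g(Y, Z)) = g(∇_X Y, Z) + g(Y, ∇_X Z)`. In Mathlib's argument order `nabla Y x v` is
`(∇_v Y)(x)`. -/
structure PseudoRiemannianMetric.IsLeviCivita {p q n : ℕ} {M : Type*} [TopologicalSpace M]
    [ChartedSpace (EuclideanSpace ℝ (Fin n)) M] [IsManifold (𝓡 n) ∞ M]
    (g : PseudoRiemannianMetric p q n M)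
    (nabla : CovariantDerivative (𝓡 n) (EuclideanSpace ℝ (Fin n))
      (TangentSpace (𝓡 n) : M → Type _)) : Prop where
  torsion_free : nabla.torsion = 0
  metric : ∀ Y Z : Π x : M, TangentSpace (𝓡 n) x,
    IsSmoothVectorField Y → IsSmoothVectorField Z →
    ∀ (x : M) (v : TangentSpace (𝓡 n) x),
      mvfderiv (𝓡 n) (fun y ↦ g.val y (Y y) (Z y)) x v =
        g.val x (nabla Y x v) (Z x) + g.val x (Y x) (nabla Z x v)

/-- A smooth distribution of rank `r` on an `n`-manifold: an `r`-dimensional subspace of each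
tangent space, locally spanned by `r` smooth vector fields. -/
structure TangentDistribution (r n : ℕ) (M : Type*) [TopologicalSpace M]
    [ChartedSpace (EuclideanSpace ℝ (Fin n)) M] [IsManifold (𝓡 n) ∞ M] where
  /-- The subspace of the tangent space at each point. -/
  fiber : ∀ x : M, Submodule ℝ (TangentSpace (𝓡 n) x)
  finrank_fiber : ∀ x : M, Module.finrank ℝ (fiber x) = r
  exists_local_frame : ∀ x : M, ∃ U : Set M, IsOpen U ∧ x ∈ U ∧
    ∃ X : Fin r → Π y : M, TangentSpace (𝓡 n) y,
      (∀ i, ContMDiffOn (𝓡 n) ((𝓡 n).prod 𝓘(ℝ, EuclideanSpace ℝ (Fin n))) ∞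
        (fun y ↦ (⟨y, X i y⟩ : TangentBundle (𝓡 n) M)) U) ∧
      ∀ y ∈ U, Submodule.span ℝ (Set.range fun i ↦ X i y) = fiber y

namespace TangentDistribution

variable {r n : ℕ} {M : Type*} [TopologicalSpace M]
  [ChartedSpace (EuclideanSpace ℝ (Fin n)) M] [IsManifold (𝓡 n) ∞ M]

/-- `X ∈ Γ(D)`: a smooth vector field with values in `D`. -/
def IsSection (D : TangentDistribution r n M) (X : Π x : M, TangentSpace (𝓡 n) x) : Prop :=
  IsSmoothVectorField X ∧ ∀ x, X x ∈ D.fiber x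

/-- `D` is parallel for `nabla`: `∇_X Y ∈ Γ(D)` for all `X ∈ Γ(TM)` and `Y ∈ Γ(D)`. -/
def IsParallel (D : TangentDistribution r n M)
    (nabla : CovariantDerivative (𝓡 n) (EuclideanSpace ℝ (Fin n))
      (TangentSpace (𝓡 n) : M → Type _)) : Prop :=
  ∀ X Y : Π x : M, TangentSpace (𝓡 n) x, IsSmoothVectorField X → D.IsSection Y →
    D.IsSection (fun x ↦ nabla Y x (X x))

/-- `D` is totally isotropic (null): `g(Y, Z) = 0` for all `Y, Z ∈ Γ(D)`. -/
def IsTotallyIsotropic {p q : ℕ} (D : TangentDistribution r n M) (g : PseudoRiemannianMetric p q n M) :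
    Prop :=
  ∀ Y Z : Π x : M, TangentSpace (𝓡 n) x, D.IsSection Y → D.IsSection Z →
    ∀ x, g.val x (Y x) (Z x) = 0

/-- `D` is involutive: `[X, Y] ∈ Γ(D)` for all `X, Y ∈ Γ(D)`. -/
def IsInvolutive (D : TangentDistribution r n M) : Prop :=
  ∀ X Y : Π x : M, TangentSpace (𝓡 n) x, D.IsSection X → D.IsSection Y →
    D.IsSection (VectorField.mlieBracket (𝓡 n) X Y)

end TangentDistribution

/-- Two charts of an `n`-manifold are compatible as foliated charts with `r`-dimensional plaques:
writing a point of `ℝⁿ` as `(x, y)` with `x` the first `r` and `y` the last `n - r` coordinates,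
the transition map has locally the form `(x, y) ↦ (h₁(x, y), h₂(y))`, i.e. locally the last `n - r`
coordinates of its value depend only on the last `n - r` coordinates of the argument. -/
def FoliatedCompatible {n : ℕ} {M : Type*} [TopologicalSpace M] (r : ℕ)
    (e e' : OpenPartialHomeomorph M (EuclideanSpace ℝ (Fin n))) : Prop :=
  ∀ z ∈ (e.symm.trans e').source, ∃ W : Set (EuclideanSpace ℝ (Fin n)),
    IsOpen W ∧ z ∈ W ∧ W ⊆ (e.symm.trans e').source ∧
    ∀ w ∈ W, ∀ w' ∈ W, (∀ i : Fin n, r ≤ (i : ℕ) → w i = w' i) →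
      ∀ i : Fin n, r ≤ (i : ℕ) → (e.symm.trans e') w i = (e.symm.trans e') w' i

/-- A smooth foliation of dimension `r` on an `n`-manifold, given by its maximal foliated atlas:
a family of smooth charts that cover the manifold, have pairwise transition maps locally of the
form `(x, y) ↦ (h₁(x, y), h₂(y))`, and is maximal with these properties. The plaques are the level
sets of the last `n - r` coordinates in the charts of the family. -/
structure Foliation (r n : ℕ) (M : Type*) [TopologicalSpace M]
    [ChartedSpace (EuclideanSpace ℝ (Fin n)) M] [IsManifold (𝓡 n) ∞ M] where
  dim_le : r ≤ n
  /-- The foliated charts. -/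
  charts : Set (OpenPartialHomeomorph M (EuclideanSpace ℝ (Fin n)))
  charts_subset : charts ⊆ IsManifold.maximalAtlas (𝓡 n) ∞ M
  covers : ∀ x : M, ∃ e ∈ charts, x ∈ e.source
  compatible : ∀ e ∈ charts, ∀ e' ∈ charts, FoliatedCompatible r e e'
  maximal : ∀ e ∈ IsManifold.maximalAtlas (𝓡 n) ∞ M,
    (∀ e' ∈ charts, FoliatedCompatible r e e' ∧ FoliatedCompatible r e' e) → e ∈ charts

/-- `D` is the tangent distribution of the foliation `F` (`D` integrates to `F`): at every point
of every foliated chart, `D` is the tangent space of the plaque, i.e. the common kernel of the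
differentials of the last `n - r` coordinates. -/
def Foliation.IsTangentTo {r n : ℕ} {M : Type*} [TopologicalSpace M]
    [ChartedSpace (EuclideanSpace ℝ (Fin n)) M] [IsManifold (𝓡 n) ∞ M]
    (F : Foliation r n M) (D : TangentDistribution r n M) : Prop :=
  ∀ e ∈ F.charts, ∀ x ∈ e.source, ∀ v : TangentSpace (𝓡 n) x,
    v ∈ D.fiber x ↔ ∀ i : Fin n, r ≤ (i : ℕ) → mvfderiv (𝓡 n) e x v i = 0

end

/-! Since `nabla` is torsion-free, `[X, Y] = ∇_X Y - ∇_Y X`, and both terms lie in `D` when `D` is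
parallel; this is involutivity. The rest is the Frobenius theorem.

The foliation consists of all flat charts, those in which `D` is the common kernel of the last `n -
r` differentials. Transition maps between flat charts preserve this kernel and hence are foliated;
conversely, a chart compatible with flat charts is flat. This gives maximality and uniqueness
(`Foliation.isTangentTo_iff`), so only the existence of flat charts remains.

For that, a local frame is renormalised so that a fixed projection inverts it; involutivity then
forces its brackets to vanish (`exists_straightening_of_involutive`). Commuting fields have a smooth
exponential map `Φ` with `∂Φ/∂a = W(Φ)` (`exists_exponential_map`), and flowing out of a transversal
straightens them. Smoothness of `Φ` in all variables comes from the inverse function theorem in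
`C([0, 1], E)`, applied to the integral equation of `γ' = W(γ) a`. -/

namespace ContinuousMap

/-! ### Smooth operators on spaces of continuous paths -/

open scoped Topology

universe u

variable {K : Type*} [TopologicalSpace K] [CompactSpace K]

set_option synthInstance.maxHeartbeats 400000 in
/-- Pointwise application of a continuous family of continuous linear maps, as a continuous
bilinear map. -/
noncomputable def applyL {E G : Type*} [NormedAddCommGroup E] [NormedSpace ℝ E]
    [NormedAddCommGroup G] [NormedSpace ℝ G] :
    C(K, E →L[ℝ] G) →L[ℝ] C(K, E) →L[ℝ] C(K, G) :=
  LinearMap.mkContinuous₂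
    (LinearMap.mk₂ ℝ (fun (A : C(K, E →L[ℝ] G)) (η : C(K, E)) ↦
        (⟨fun t ↦ A t (η t), A.continuous.clm_apply η.continuous⟩ : C(K, G)))
      (fun _ _ _ ↦ by ext; simp) (fun _ _ _ ↦ by ext; simp)
      (fun _ _ _ ↦ by ext; simp) (fun _ _ _ ↦ by ext; simp))
    1 fun A η ↦ by
      rw [one_mul]
      refine (ContinuousMap.norm_le _ (by positivity)).2 fun t ↦ ?_
      exact ((A t).le_opNorm _).trans
        (mul_le_mul (A.norm_coe_le_norm t) (η.norm_coe_le_norm t) (by positivity) (by positivity))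

@[simp]
theorem applyL_apply {E G : Type*} [NormedAddCommGroup E] [NormedSpace ℝ E]
    [NormedAddCommGroup G] [NormedSpace ℝ G] (A : C(K, E →L[ℝ] G)) (η : C(K, E)) (t : K) :
    applyL A η t = A t (η t) := rfl

/-- The inclusion of the constant functions, as a continuous linear map. -/
noncomputable def constCLM (E : Type*) [NormedAddCommGroup E] [NormedSpace ℝ E] : E →L[ℝ] C(K, E) :=
  LinearMap.mkContinuous
    { toFun := fun x ↦ ContinuousMap.const K x
      map_add' := fun _ _ ↦ rfl
      map_smul' := fun _ _ ↦ rfl } 1 fun x ↦ by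
      rw [one_mul]
      exact (ContinuousMap.norm_le _ (norm_nonneg x)).2 fun t ↦ le_rfl

@[simp]
theorem constCLM_apply {E : Type*} [NormedAddCommGroup E] [NormedSpace ℝ E] (x : E) (t : K) :
    constCLM (K := K) E x t = x := rfl

/-- The derivative of the superposition operator `γ ↦ f ∘ γ` is pointwise application of `f'`. -/
theorem hasFDerivAt_comp_left {E G : Type*} [NormedAddCommGroup E] [NormedSpace ℝ E]
    [NormedAddCommGroup G] [NormedSpace ℝ G] {f : E → G} {f' : E → E →L[ℝ] G}
    (hf : ∀ x, HasFDerivAt f (f' x) x) (hc : Continuous f) (hc' : Continuous f') (γ : C(K, E)) :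
    HasFDerivAt (fun γ : C(K, E) ↦ (⟨f, hc⟩ : C(E, G)).comp γ)
      (applyL ((⟨f', hc'⟩ : C(E, E →L[ℝ] G)).comp γ)) γ := by
  rw [hasFDerivAt_iff_isLittleO_nhds_zero, Asymptotics.isLittleO_iff]
  intro c hcpos
  have hcpt : IsCompact (Set.range γ) := isCompact_range γ.continuous
  -- Compactness of the image of `γ` yields one `δ` for all `t`, so the mean value estimate below is
  -- uniform in `t`, as the sup norm requires.
  have hu := hcpt.uniformContinuousAt_of_continuousAt f' (fun x _ ↦ hc'.continuousAt)
    (Metric.dist_mem_uniformity hcpos)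
  obtain ⟨δ, hδ, hδ'⟩ := Metric.mem_uniformity_dist.1 hu
  filter_upwards [Metric.ball_mem_nhds (0 : C(K, E)) hδ] with η hη
  rw [mem_ball_zero_iff] at hη
  refine (ContinuousMap.norm_le _ (by positivity)).2 fun t ↦ ?_
  have hηt : ‖η t‖ < δ := (η.norm_coe_le_norm t).trans_lt hη
  have key := (convex_ball (γ t) δ).norm_image_sub_le_of_norm_hasFDerivWithin_le'
    (f := f) (f' := f') (φ := f' (γ t)) (C := c) (x := γ t) (y := γ t + η t)
    (fun x _ ↦ (hf x).hasFDerivWithinAt) (fun x hx ↦ ?_) (Metric.mem_ball_self hδ) (by simpa)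
  · simp only [add_sub_cancel_left] at key
    exact le_trans (by simpa using key)
      (mul_le_mul_of_nonneg_left (η.norm_coe_le_norm t) hcpos.le)
  · have := hδ' (a := γ t) (b := x) (by rw [dist_comm]; exact hx) (Set.mem_range_self t)
    rw [← dist_eq_norm, dist_comm]
    exact le_of_lt this

/-- The superposition operator of a smooth map is smooth. -/
theorem contDiff_comp_left_nat {E : Type u} [NormedAddCommGroup E] [NormedSpace ℝ E] (m : ℕ) :
    ∀ {G : Type u} [NormedAddCommGroup G] [NormedSpace ℝ G] {f : E → G} (hf : ContDiff ℝ m f),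
    ContDiff ℝ m (fun γ : C(K, E) ↦ (⟨f, hf.continuous⟩ : C(E, G)).comp γ) := by
  induction m with
  | zero =>
    intro G _ _ f hf
    exact contDiff_zero.2 (ContinuousMap.continuous_postcomp _)
  | succ m ih =>
    intro G _ _ f hf
    obtain ⟨f', hf', hd⟩ := (contDiff_succ_iff_hasFDerivAt (n := m)).1 (by exact_mod_cast hf)
    refine (contDiff_succ_iff_hasFDerivAt (n := m)).2 ⟨_, ?_,
      fun γ ↦ hasFDerivAt_comp_left hd hf.continuous hf'.continuous γ⟩
    -- The derivative is the superposition operator of `f'` followed by the linear map `applyL`, so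
    -- the induction changes the codomain to `E →L[ℝ] G`; the common universe `u` keeps this type in
    -- range.
    have h := ih (G := E →L[ℝ] G) hf'
    have hL : ContDiff ℝ m (applyL (K := K) (E := E) (G := G)) := ContinuousLinearMap.contDiff _
    exact hL.comp h

theorem contDiff_comp_left {E G : Type u} [NormedAddCommGroup E] [NormedSpace ℝ E]
    [NormedAddCommGroup G] [NormedSpace ℝ G] {f : E → G} (hf : ContDiff ℝ ∞ f) :
    ContDiff ℝ ∞ (fun γ : C(K, E) ↦ (⟨f, hf.continuous⟩ : C(E, G)).comp γ) :=
  contDiff_infty.2 fun m ↦ contDiff_comp_left_nat m (hf.of_le (mod_cast le_top))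

/-- The primitive vanishing at `0`, as a continuous linear map on continuous paths. -/
noncomputable def primitiveCLM (E : Type*) [NormedAddCommGroup E] [NormedSpace ℝ E] :
    C(unitInterval, E) →L[ℝ] C(unitInterval, E) :=
  LinearMap.mkContinuous
    { toFun := fun η ↦ ⟨fun t ↦ ∫ s in (0 : ℝ)..t, Set.IccExtend zero_le_one η s,
        (intervalIntegral.continuous_primitive
          (fun _ _ ↦ (η.continuous.Icc_extend').intervalIntegrable _ _) 0).comp
          continuous_subtype_val⟩
      map_add' := fun η ζ ↦ by
        ext t
        exact intervalIntegral.integral_add (η.continuous.Icc_extend'.intervalIntegrable _ _)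
          (ζ.continuous.Icc_extend'.intervalIntegrable _ _)
      map_smul' := fun c η ↦ by
        ext t
        exact intervalIntegral.integral_smul c _ } 1 fun η ↦ by
      rw [one_mul]
      refine (ContinuousMap.norm_le _ (norm_nonneg η)).2 fun t ↦ ?_
      refine (intervalIntegral.norm_integral_le_of_norm_le_const (C := ‖η‖)
        fun s _ ↦ η.norm_coe_le_norm _).trans ?_
      rw [sub_zero, abs_of_nonneg t.2.1]
      exact mul_le_of_le_one_right (norm_nonneg η) t.2.2

theorem primitiveCLM_apply {E : Type*} [NormedAddCommGroup E] [NormedSpace ℝ E]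
    (η : C(unitInterval, E)) (t : unitInterval) :
    primitiveCLM E η t = ∫ s in (0 : ℝ)..t, Set.IccExtend zero_le_one η s := rfl

/-- A path starting at `0` is the primitive of its derivative. -/
theorem primitiveCLM_eq {E : Type*} [NormedAddCommGroup E] [NormedSpace ℝ E] [CompleteSpace E]
    {c : ℝ → E} {η ζ : C(unitInterval, E)} (hη : ∀ t : unitInterval, η t = c t) (h0 : c 0 = 0)
    (hd : ∀ t : unitInterval, HasDerivAt c (ζ t) t) :
    primitiveCLM E ζ = η := by
  ext t
  rw [primitiveCLM_apply, hη, intervalIntegral.integral_eq_sub_of_hasDerivAt (f := c) ?_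
    (ζ.continuous.Icc_extend'.intervalIntegrable _ _), h0, sub_zero]
  intro s hs
  rw [Set.uIcc_of_le t.2.1] at hs
  have hs' : s ∈ Set.Icc (0 : ℝ) 1 := ⟨hs.1, hs.2.trans t.2.2⟩
  simpa [Set.IccExtend_of_mem _ _ hs'] using hd ⟨s, hs'⟩

/-- The primitive of a continuous path is differentiable. -/
theorem hasDerivAt_primitiveCLM {E : Type*} [NormedAddCommGroup E] [NormedSpace ℝ E]
    [CompleteSpace E] (η : C(unitInterval, E)) (t : unitInterval) :
    HasDerivAt (fun t ↦ ∫ s in (0 : ℝ)..t, Set.IccExtend zero_le_one η s) (η t) t := by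
  have h : Continuous (Set.IccExtend (zero_le_one (α := ℝ)) η) := η.continuous.Icc_extend'
  simpa using h.integral_hasStrictDerivAt 0 (t : ℝ) |>.hasDerivAt

end ContinuousMap

/-! ### Exponential map of commuting vector fields -/

section ExponentialMap

open scoped Topology unitInterval

/-- The inverse function theorem on an open set: a smooth map with invertible derivative at a
point restricts to a diffeomorphism between open sets, all of whose derivatives are invertible. -/
theorem ContDiffOn.exists_openPartialHomeomorph {X Y : Type*} [NormedAddCommGroup X]
    [NormedSpace ℝ X] [CompleteSpace X] [NormedAddCommGroup Y] [NormedSpace ℝ Y]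
    {f : X → Y} {s : Set X} (hf : ContDiffOn ℝ ∞ f s) (hs : IsOpen s) {a : X} (ha : a ∈ s)
    {f' : X ≃L[ℝ] Y} (hf' : HasFDerivAt f (f' : X →L[ℝ] Y) a) :
    ∃ e : OpenPartialHomeomorph X Y, a ∈ e.source ∧ e.source ⊆ s ∧ (e : X → Y) = f ∧
      ContDiffOn ℝ ∞ e.symm e.target ∧
      ∀ x ∈ e.source, ∃ g : X ≃L[ℝ] Y, HasFDerivAt f (g : X →L[ℝ] Y) x := by
  -- Invertibility of the derivative is an open condition. Shrinking to it makes the inverse smooth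
  -- on its whole target, not just at `f a`.
  have hT : IsOpen (s ∩ fderiv ℝ f ⁻¹' Set.range ((↑) : (X ≃L[ℝ] Y) → X →L[ℝ] Y)) :=
    (hf.continuousOn_fderiv_of_isOpen hs (by simp)).isOpen_inter_preimage hs
      (ContinuousLinearEquiv.isOpen)
  have hfa : ContDiffAt ℝ ∞ f a := hf.contDiffAt (hs.mem_nhds ha)
  let e₀ := hfa.toOpenPartialHomeomorph f hf' (by simp)
  have hinv : ∀ x ∈ (e₀.restrOpen _ hT).source,
      ∃ g : X ≃L[ℝ] Y, HasFDerivAt f (g : X →L[ℝ] Y) x := by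
    intro x hx
    obtain ⟨-, hxs, g, hg⟩ := (e₀.restrOpen_source _ hT) ▸ hx
    refine ⟨g, ?_⟩
    rw [hg]
    exact ((hf.contDiffAt (hs.mem_nhds hxs)).differentiableAt (by simp)).hasFDerivAt
  refine ⟨e₀.restrOpen _ hT, ?_, ?_, rfl, ?_, hinv⟩
  · rw [e₀.restrOpen_source]
    exact ⟨hfa.mem_toOpenPartialHomeomorph_source hf' (by simp), ha, f', hf'.fderiv.symm⟩
  · rw [e₀.restrOpen_source]
    exact fun x hx ↦ hx.2.1
  · intro y hy
    have hx := (e₀.restrOpen _ hT).map_target hy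
    obtain ⟨g, hg⟩ := hinv _ hx
    refine ((e₀.restrOpen _ hT).contDiffAt_symm hy (f₀' := g) hg ?_).contDiffWithinAt
    rw [e₀.restrOpen_source] at hx
    exact hf.contDiffAt (hs.mem_nhds hx.2.1)

open ContinuousMap

universe u

set_option synthInstance.maxHeartbeats 400000

variable {B E : Type u} [NormedAddCommGroup B] [NormedSpace ℝ B]
  [NormedAddCommGroup E] [NormedSpace ℝ E]

/-- The defect of a path `γ` from being a solution on `[0, 1]` of `γ' = W(γ) a`, `γ(0) = p`, as a
function of `((a, p), γ)`. -/
noncomputable def odeDefect (W : C(E, B →L[ℝ] E)) (z : (B × E) × C(I, E)) : C(I, E) :=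
  z.2 - constCLM E z.1.2 - primitiveCLM E (applyL (W.comp z.2) (constCLM B z.1.1))

theorem contDiff_odeDefect {W : C(E, B →L[ℝ] E)} (hW : ContDiff ℝ ∞ W) :
    ContDiff ℝ ∞ (odeDefect W) := by
  have h1 : ContDiff ℝ ∞ fun z : (B × E) × C(I, E) ↦ W.comp z.2 :=
    (contDiff_comp_left (K := I) hW).comp contDiff_snd
  have hL : ContDiff ℝ ∞ (applyL (K := I) (E := B) (G := E)) := ContinuousLinearMap.contDiff _
  have h2 : ContDiff ℝ ∞ fun z : (B × E) × C(I, E) ↦ constCLM (K := I) B z.1.1 :=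
    (constCLM (K := I) B).contDiff.comp (contDiff_fst.comp contDiff_fst)
  have h3 : ContDiff ℝ ∞ fun z : (B × E) × C(I, E) ↦ constCLM (K := I) E z.1.2 :=
    (constCLM (K := I) E).contDiff.comp (contDiff_snd.comp contDiff_fst)
  exact (contDiff_snd.sub h3).sub
    ((primitiveCLM E).contDiff.comp ((hL.comp h1).clm_apply h2))

/-- The explicit formula serves twice: at `a = 0` the term in `W'` vanishes, which makes the partial
derivative in `γ` the identity; along a solution, `L ((b, 0), η) = 0` is the variational equation.
-/
theorem hasFDerivAt_odeDefect {W : C(E, B →L[ℝ] E)} {W' : C(E, E →L[ℝ] B →L[ℝ] E)}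
    (hW : ∀ x, HasFDerivAt W (W' x) x) (z : (B × E) × C(I, E)) :
    ∃ L : (B × E) × C(I, E) →L[ℝ] C(I, E), HasFDerivAt (odeDefect W) L z ∧
      ∀ w, L w = w.2 - constCLM E w.1.2 - primitiveCLM E
        (applyL (W.comp z.2) (constCLM B w.1.1) +
          applyL (applyL (W'.comp z.2) w.2) (constCLM B z.1.1)) := by
  have h1 : HasFDerivAt (fun z : (B × E) × C(I, E) ↦ W.comp z.2) _ z :=
    (hasFDerivAt_comp_left hW W.continuous W'.continuous z.2).comp z hasFDerivAt_snd
  have h2 : HasFDerivAt (fun z : (B × E) × C(I, E) ↦ constCLM (K := I) B z.1.1) _ z :=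
    (constCLM (K := I) B).hasFDerivAt.comp z (hasFDerivAt_fst.comp z hasFDerivAt_fst)
  have h3 : HasFDerivAt (fun z : (B × E) × C(I, E) ↦ constCLM (K := I) E z.1.2) _ z :=
    (constCLM (K := I) E).hasFDerivAt.comp z (hasFDerivAt_snd.comp z hasFDerivAt_fst)
  exact ⟨_, (hasFDerivAt_snd.sub h3).sub ((primitiveCLM E).hasFDerivAt.comp z ((applyL (K := I) (E := B) (G := E)).hasFDerivAt_of_bilinear h1 h2)),
    fun w ↦ rfl⟩

/-- The variation of the solution of `γ' = W(γ) a` in the direction `b` of the parameter is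
`t ↦ t W(γ t) b`, if the constant combinations of the fields `W` commute along `γ`. -/
theorem odeDefect_variation [CompleteSpace E] {W : C(E, B →L[ℝ] E)}
    {W' : C(E, E →L[ℝ] B →L[ℝ] E)}
    (hW : ∀ x, HasFDerivAt W (W' x) x) {a : B} {p : E} {γ : C(I, E)}
    (hγ : odeDefect W ((a, p), γ) = 0)
    (hcomm : ∀ t (a b : B), W' (γ t) (W (γ t) a) b = W' (γ t) (W (γ t) b) a) (b : B)
    {η : C(I, E)} (hη : ∀ t : I, η t = (t : ℝ) • W (γ t) b) :
    primitiveCLM E (applyL (W.comp γ) (constCLM B b) +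
      applyL (applyL (W'.comp γ) η) (constCLM B a)) = η := by
  -- The integral equation extends `γ` beyond `[0, 1]`, so two-sided derivatives exist at the end
  -- points too.
  set c : ℝ → E := fun t ↦ p + ∫ s in (0 : ℝ)..t,
    Set.IccExtend zero_le_one (applyL (W.comp γ) (constCLM B a)) s
  have hc : ∀ t : I, γ t = c t := fun t ↦ by
    have := congr($hγ t)
    simp only [odeDefect, ContinuousMap.sub_apply, primitiveCLM_apply, constCLM_apply,
      ContinuousMap.zero_apply] at this
    simp only [c]
    rw [← sub_eq_zero, ← this]
    abel
  have hc' : ∀ t : I, HasDerivAt c (W (γ t) a) t := fun t ↦ by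
    exact (hasDerivAt_primitiveCLM (applyL (W.comp γ) (constCLM B a)) t).const_add p
  refine primitiveCLM_eq (c := fun t ↦ t • W (c t) b) (fun t ↦ by rw [hη, hc]) (by simp)
    fun t ↦ ?_
  have h1 : HasDerivAt (fun t ↦ W (c t)) (W' (γ t) (W (γ t) a)) t := by
    have := hW (γ t)
    rw [hc] at this ⊢
    exact this.comp_hasDerivAt (t : ℝ) (by simpa [hc] using hc' t)
  have h2 : HasDerivAt (fun t ↦ W (c t) b) (W' (γ t) (W (γ t) a) b) t := by
    simpa using h1.clm_apply (hasDerivAt_const (t : ℝ) b)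
  convert (hasDerivAt_id (t : ℝ)).smul h2 using 1
  · rfl
  -- The product rule yields `t W'(W a) b`, whereas the variational equation asks for `t W'(W b) a`;
  -- commutation identifies them.
  · rw [hcomm t a b]
    simp [hη, ← hc, add_comm]

/-- The exponential map of commuting vector fields: if `W` is a smooth family of vector fields
whose constant combinations commute on the open set `U`, then there is a smooth solution
near `(0, x₀)` of `∂Φ(a, p)/∂a = W(Φ(a, p))`, `Φ(0, p) = p`. -/
theorem exists_exponential_map [CompleteSpace B] [CompleteSpace E] {W : E → B →L[ℝ] E}
    (hW : ContDiff ℝ ∞ W) {U : Set E} (hU : IsOpen U)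
    (hcomm : ∀ x ∈ U, ∀ a b : B, fderiv ℝ W x (W x a) b = fderiv ℝ W x (W x b) a)
    {x₀ : E} (hx₀ : x₀ ∈ U) :
    ∃ (N : Set (B × E)) (Φ : B × E → E), IsOpen N ∧ (0, x₀) ∈ N ∧ ContDiffOn ℝ ∞ Φ N ∧
      (∀ p, (0, p) ∈ N → Φ (0, p) = p) ∧
      ∀ q ∈ N, Φ q ∈ U ∧ ∀ b : B, fderiv ℝ Φ q (b, 0) = W (Φ q) b := by
  let Wc : C(E, B →L[ℝ] E) := ⟨W, hW.continuous⟩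
  let Wc' : C(E, E →L[ℝ] B →L[ℝ] E) := ⟨fderiv ℝ W, hW.continuous_fderiv (by simp)⟩
  have hWd : ∀ x, HasFDerivAt Wc (Wc' x) x := fun x ↦
    (hW.differentiable (by simp) x).hasFDerivAt
  -- Carrying the parameters along turns the implicit equation `odeDefect = 0` into an inverse
  -- function problem.
  let G : (B × E) × C(I, E) → (B × E) × C(I, E) := fun z ↦ (z.1, odeDefect Wc z)
  have hG : ContDiff ℝ ∞ G := contDiff_fst.prodMk (contDiff_odeDefect hW)
  have hdefect0 : ∀ p, odeDefect Wc ((0, p), constCLM E p) = 0 := fun p ↦ by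
    simp [odeDefect]
  let s : Set ((B × E) × C(I, E)) := {z | ∀ t, z.2 t ∈ U}
  have hs : IsOpen s := by
    have := (ContinuousMap.isOpen_setOfPred_mapsTo (isCompact_univ (X := I)) hU).preimage
      (continuous_snd (X := B × E))
    simpa [s, Set.MapsTo] using this
  obtain ⟨L, hL, hLw⟩ := hasFDerivAt_odeDefect (B := B) hWd ((0, x₀), constCLM E x₀)
  let z₀ : (B × E) × C(I, E) := ((0, x₀), constCLM E x₀)
  let R : B × E →L[ℝ] C(I, E) := L.comp (ContinuousLinearMap.inl ℝ _ _)
  have hLR : ∀ w, L w = w.2 + R w.1 := fun w ↦ by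
    simp only [R, ContinuousLinearMap.comp_apply, ContinuousLinearMap.inl_apply, hLw]
    simp
    abel
  let G' : ((B × E) × C(I, E)) ≃L[ℝ] (B × E) × C(I, E) :=
    ContinuousLinearEquiv.equivOfInverse
      ((ContinuousLinearMap.fst ℝ _ _).prod L)
      ((ContinuousLinearMap.fst ℝ _ _).prod
        (ContinuousLinearMap.snd ℝ _ _ - R.comp (ContinuousLinearMap.fst ℝ _ _)))
      (fun w ↦ by ext1 <;> simp [hLR]) (fun w ↦ by ext1 <;> simp [hLR])
  obtain ⟨e, hz₀, hes, heG, hesymm, heinv⟩ := hG.contDiffOn.exists_openPartialHomeomorph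
    (f' := G') hs (a := z₀) (fun t ↦ hx₀) (hasFDerivAt_fst.prodMk hL)
  have heapp : ∀ z, e z = (z.1, odeDefect Wc z) := fun z ↦ by rw [heG]
  let ι : B × E → (B × E) × C(I, E) := fun q ↦ (q, 0)
  have hι : ContDiff ℝ ∞ ι := contDiff_id.prodMk contDiff_const
  let κ : B × E → (B × E) × C(I, E) := fun q ↦ (q, constCLM E q.2)
  have hκ : Continuous κ := by fun_prop
  let Γ : B × E → C(I, E) := fun q ↦ (e.symm (q, 0)).2
  have hz : ∀ q, ι q ∈ e.target → e.symm (q, 0) = (q, Γ q) ∧ odeDefect Wc (q, Γ q) = 0 := by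
    intro q hq
    have h := e.right_inv hq
    rw [heapp] at h
    have h1 : e.symm (q, 0) = (q, Γ q) := by
      ext1
      · exact congr(($h).1)
      · rfl
    refine ⟨h1, ?_⟩
    have h2 := congr(($h).2)
    simp only [ι, h1] at h2
    exact h2
  -- The second condition puts the constant path at `p` in the domain of `e`. For `a = 0` it is a
  -- solution, so local injectivity makes it the selected one and `Φ (0, p) = p`.
  let N : Set (B × E) := ι ⁻¹' e.target ∩ κ ⁻¹' e.source
  have hN : IsOpen N := (e.open_target.preimage hι.continuous).inter (e.open_source.preimage hκ)
  have hΓ : ContDiffOn ℝ ∞ Γ N :=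
    contDiff_snd.comp_contDiffOn (hesymm.comp hι.contDiffOn fun q hq ↦ hq.1)
  let ev : C(I, E) →L[ℝ] E := ContinuousMap.evalCLM ℝ (1 : I)
  refine ⟨N, fun q ↦ Γ q 1, hN, ⟨?_, hz₀⟩, ev.contDiff.comp_contDiffOn hΓ, ?_, ?_⟩
  · have := e.map_source hz₀
    rw [heapp, hdefect0] at this
    exact this
  · rintro p ⟨hp1, hp2⟩
    have : e.symm (e (κ (0, p))) = κ (0, p) := e.left_inv hp2
    rw [heapp] at this
    simp only [κ, hdefect0] at this
    simp [Γ, this]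
  · rintro ⟨a, p⟩ hq
    obtain ⟨hz1, hz2⟩ := hz _ hq.1
    have hsrc : ((a, p), Γ (a, p)) ∈ e.source := hz1 ▸ e.map_target hq.1
    have hγU : ∀ t, Γ (a, p) t ∈ U := fun t ↦ hes (hz1 ▸ hsrc) t
    refine ⟨hγU 1, fun b ↦ ?_⟩
    have hdΓ : HasFDerivAt Γ (fderiv ℝ Γ (a, p)) (a, p) :=
      ((hΓ.contDiffAt (hN.mem_nhds hq)).differentiableAt (by simp)).hasFDerivAt
    obtain ⟨L, hL, hLw⟩ := hasFDerivAt_odeDefect hWd ((a, p), Γ (a, p))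
    obtain ⟨g, hg⟩ := heinv _ hsrc
    have hgL : (g : _ →L[ℝ] _) = (ContinuousLinearMap.fst ℝ _ _).prod L :=
      hg.unique (hasFDerivAt_fst.prodMk hL)
    have hzero : HasFDerivAt (fun q ↦ odeDefect Wc (q, Γ q))
        (L.comp ((ContinuousLinearMap.id ℝ _).prod (fderiv ℝ Γ (a, p)))) (a, p) :=
      HasFDerivAt.comp (f := fun q ↦ (q, Γ q)) (a, p) hL ((hasFDerivAt_id _).prodMk hdΓ)
    have hzero' : L.comp ((ContinuousLinearMap.id ℝ _).prod (fderiv ℝ Γ (a, p))) = 0 := by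
      refine hzero.unique ((hasFDerivAt_const (0 : C(I, E)) (a, p)).congr_of_eventuallyEq ?_)
      filter_upwards [hN.mem_nhds hq] with q hq using (hz q hq.1).2
    let η : C(I, E) := ⟨fun t ↦ (t : ℝ) • W (Γ (a, p) t) b,
      continuous_subtype_val.smul
        ((hW.continuous.comp (Γ (a, p)).continuous).clm_apply continuous_const)⟩
    have hη := odeDefect_variation hWd hz2 (fun t ↦ hcomm _ (hγU t)) b (η := η) fun t ↦ rfl
    have hLη : L ((b, 0), η) = 0 := by
      rw [hLw]
      simp only [hη]
      simp
    have hLΓ : L ((b, 0), fderiv ℝ Γ (a, p) (b, 0)) = 0 := congr($hzero' (b, 0))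
    -- Both vectors solve the linearised equation with the same parameter variation, and `g` is
    -- injective; hence `∂Γ/∂b = η`, whose value at time `1` is `W(Φ) b`.
    have hgη : g ((b, 0), fderiv ℝ Γ (a, p) (b, 0)) = g ((b, 0), η) := by
      have := fun w ↦ congr($hgL w)
      simp only [ContinuousLinearEquiv.coe_coe] at this
      rw [this, this]
      simp [hLη, hLΓ]
    have hΓη : fderiv ℝ Γ (a, p) (b, 0) = η := congr(($(g.injective hgη)).2)
    have hev : HasFDerivAt (fun q ↦ Γ q 1) (ev.comp (fderiv ℝ Γ (a, p))) (a, p) :=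
      ev.hasFDerivAt.comp _ hdΓ
    rw [hev.fderiv, ContinuousLinearMap.comp_apply, hΓη]
    simp [ev, η]

end ExponentialMap

/-! ### Local Frobenius theorem in a vector space -/

section Frobenius

open scoped Topology

universe u

/-- Every function that is smooth on an open set agrees near a given point of this set with a
globally smooth function. -/
theorem ContDiffOn.exists_contDiff_eventuallyEq {E F : Type*} [NormedAddCommGroup E]
    [NormedSpace ℝ E] [HasContDiffBump E] [NormedAddCommGroup F] [NormedSpace ℝ F]
    {f : E → F} {V : Set E} (hf : ContDiffOn ℝ ∞ f V) (hV : IsOpen V) {x₀ : E} (hx₀ : x₀ ∈ V) :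
    ∃ g : E → F, ContDiff ℝ ∞ g ∧ g =ᶠ[𝓝 x₀] f := by
  obtain ⟨δ, hδ, hδV⟩ := Metric.nhds_basis_closedBall.mem_iff.1 (hV.mem_nhds hx₀)
  let χ : ContDiffBump x₀ := ⟨δ / 2, δ, by positivity, by linarith⟩
  refine ⟨fun x ↦ χ x • f x, contDiff_iff_contDiffAt.2 fun x ↦ ?_, ?_⟩
  · by_cases hx : x ∈ tsupport χ
    · rw [χ.tsupport_eq] at hx
      exact χ.contDiff.contDiffAt.smul (hf.contDiffAt (hV.mem_nhds (hδV hx)))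
    · refine (contDiffAt_const (c := (0 : F))).congr_of_eventuallyEq ?_
      filter_upwards [notMem_tsupport_iff_eventuallyEq.1 hx] with y hy
      simp [hy]
  · filter_upwards [χ.eventuallyEq_one] with y hy
    simp [hy]

variable {E B C : Type u} [NormedAddCommGroup E] [NormedSpace ℝ E] [FiniteDimensional ℝ E]
  [NormedAddCommGroup B] [NormedSpace ℝ B] [FiniteDimensional ℝ B]
  [NormedAddCommGroup C] [NormedSpace ℝ C] [FiniteDimensional ℝ C]

/-- Commuting vector fields, with a complement to their span at `x₀`, can be straightened. -/
theorem exists_straightening_of_commuting {W : E → B →L[ℝ] E} {V : Set E}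
    (hW : ContDiffOn ℝ ∞ W V) (hV : IsOpen V) {x₀ : E} (hx₀ : x₀ ∈ V)
    (hcomm : ∀ x ∈ V, ∀ a b : B, fderiv ℝ W x (W x a) b = fderiv ℝ W x (W x b) a)
    (ι : C →L[ℝ] E) (g : (B × C) ≃L[ℝ] E) (hg : ∀ w, g w = W x₀ w.1 + ι w.2) :
    ∃ φ : OpenPartialHomeomorph E (B × C), x₀ ∈ φ.source ∧ φ.source ⊆ V ∧
      ContDiffOn ℝ ∞ φ φ.source ∧ ContDiffOn ℝ ∞ φ.symm φ.target ∧
      ∀ x ∈ φ.source, ∀ v, v ∈ (W x).range ↔ (fderiv ℝ φ x v).2 = 0 := by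
  have := FiniteDimensional.complete ℝ E
  have := FiniteDimensional.complete ℝ B
  have := FiniteDimensional.complete ℝ C
  -- Superposition with `W` must be defined on all paths, so `W` is replaced by a globally smooth
  -- field that agrees with it near `x₀`.
  obtain ⟨W₁, hW₁, hWW₁⟩ := hW.exists_contDiff_eventuallyEq hV hx₀
  obtain ⟨U, hUW, hU, hxU⟩ := eventually_nhds_iff.1 (hWW₁.and (hV.mem_nhds hx₀))
  have hd : ∀ x ∈ U, fderiv ℝ W₁ x = fderiv ℝ W x := fun x hx ↦
    Filter.EventuallyEq.fderiv_eq (Filter.eventually_of_mem (hU.mem_nhds hx) fun y hy ↦ (hUW y hy).1)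
  obtain ⟨N, Φ, hN, hN₀, hΦ, hΦ₀, hΦd⟩ := exists_exponential_map hW₁ hU (fun x hx a b ↦ by
    rw [hd x hx, (hUW x hx).1]; exact hcomm x (hUW x hx).2 a b) hxU
  -- `Φ ∘ j` flows for the parameter `b` from the point `x₀ + ι c` of the transversal. Its
  -- derivative at `0` is `g`, and its inverse is the desired chart.
  let j : B × C → B × E := fun w ↦ (w.1, x₀ + ι w.2)
  have hj : ContDiff ℝ ∞ j := by fun_prop
  have hjd : ∀ w, HasFDerivAt j ((ContinuousLinearMap.fst ℝ B C).prod
      (ι.comp (ContinuousLinearMap.snd ℝ B C))) w := fun w ↦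
    hasFDerivAt_fst.prodMk ((ι.hasFDerivAt.comp w hasFDerivAt_snd).const_add x₀)
  have hs : IsOpen (j ⁻¹' N) := hN.preimage hj.continuous
  have hΨ : ContDiffOn ℝ ∞ (Φ ∘ j) (j ⁻¹' N) := hΦ.comp hj.contDiffOn fun w hw ↦ hw
  have hΨd : ∀ w ∈ j ⁻¹' N, HasFDerivAt (Φ ∘ j) ((fderiv ℝ Φ (j w)).comp
      ((ContinuousLinearMap.fst ℝ B C).prod (ι.comp (ContinuousLinearMap.snd ℝ B C)))) w :=
    fun w hw ↦ HasFDerivAt.comp w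
      ((hΦ.contDiffAt (hN.mem_nhds hw)).differentiableAt (by simp)).hasFDerivAt (hjd w)
  have h0 : (0 : B × C) ∈ j ⁻¹' N := by simpa [j] using hN₀
  have hΦ₂ : ∀ v, fderiv ℝ Φ (0, x₀) (0, v) = v := by
    have h1 : HasFDerivAt (fun p : E ↦ Φ (0, p))
        ((fderiv ℝ Φ (0, x₀)).comp (ContinuousLinearMap.inr ℝ B E)) x₀ :=
      HasFDerivAt.comp (f := fun p : E ↦ ((0 : B), p)) x₀
        ((hΦ.contDiffAt (hN.mem_nhds hN₀)).differentiableAt (by simp)).hasFDerivAt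
        (hasFDerivAt_prodMk_right 0 x₀)
    have h2 : HasFDerivAt (fun p : E ↦ Φ (0, p)) (ContinuousLinearMap.id ℝ E) x₀ := by
      refine (hasFDerivAt_id x₀).congr_of_eventuallyEq ?_
      filter_upwards [(hN.preimage (Continuous.prodMk_right (0 : B))).mem_nhds hN₀] with p hp
      exact hΦ₀ p hp
    exact fun v ↦ congr($(h1.unique h2) v)
  have hg' : (g : B × C →L[ℝ] E) = (fderiv ℝ Φ (j 0)).comp
      ((ContinuousLinearMap.fst ℝ B C).prod (ι.comp (ContinuousLinearMap.snd ℝ B C))) := by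
    refine ContinuousLinearMap.ext fun w ↦ ?_
    have hj0 : j 0 = (0, x₀) := by simp [j]
    have : (w.1, ι w.2) = (w.1, 0) + ((0 : B), ι w.2) := by simp
    simp only [ContinuousLinearEquiv.coe_coe, hg, hj0, ContinuousLinearMap.comp_apply,
      ContinuousLinearMap.prod_apply, ContinuousLinearMap.coe_fst', ContinuousLinearMap.coe_snd']
    rw [this, map_add, hΦ₂, (hΦd _ hN₀).2, hΦ₀ _ hN₀, (hUW _ hxU).1]
  obtain ⟨e, he0, hes, heΨ, hesymm, heinv⟩ := hΨ.exists_openPartialHomeomorph hs h0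
    (f' := g) (by rw [hg']; exact hΨd 0 h0)
  have hmem : ∀ w ∈ e.source, e w ∈ U := fun w hw ↦ heΨ ▸ (hΦd _ (hes hw)).1
  have he0' : e 0 = x₀ := by
    rw [heΨ]
    simp only [j, Function.comp_apply, Prod.fst_zero, Prod.snd_zero, map_zero, add_zero]
    exact hΦ₀ _ hN₀
  refine ⟨e.symm, ?_, fun x hx ↦ ?_, hesymm, ?_, fun x hx v ↦ ?_⟩
  · rw [← he0']
    exact e.map_source he0
  · rw [← e.right_inv hx]
    exact (hUW _ (hmem _ (e.map_target hx))).2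
  · rw [e.symm_symm, heΨ]
    exact hΨ.mono hes
  · have hw := e.map_target hx
    obtain ⟨f, hf⟩ := heinv _ hw
    -- At every point, not only at `x₀`, the inverse chart carries the directions `B × 0` onto the
    -- range of `W`.
    have hfW : ∀ b, f (b, 0) = W x b := fun b ↦ by
      have h1 := hf.unique (hΨd _ (hes hw))
      have h2 : f (b, 0) = fderiv ℝ Φ (j (e.symm x)) (b, 0) := by
        simpa using congr($h1 (b, 0))
      have h3 : Φ (j (e.symm x)) = x := by
        have := e.right_inv hx
        rwa [heΨ] at this
      have hxU : x ∈ U := by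
        rw [← h3]
        exact (hΦd _ (hes hw)).1
      rw [h2, (hΦd _ (hes hw)).2, h3, (hUW x hxU).1]
    have hd := e.hasFDerivAt_symm hx (f' := f) (heΨ ▸ hf)
    rw [hd.fderiv]
    constructor
    · rintro ⟨b, rfl⟩
      simp [← hfW]
    · intro hv
      refine ⟨(f.symm v).1, ?_⟩
      have : f ((f.symm v).1, 0) = v := by
        rw [← f.apply_symm_apply v]
        congr 1
        ext1
        · simp
        · simpa using hv.symm
      rw [hfW] at this
      exact this

/-- **Local Frobenius theorem**: if the smooth family `Z` of vector fields is injective at `x₀`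
and the brackets of its constant combinations take values in its range, then there are
smooth coordinates near `x₀` whose second components cut out the range of `Z`. -/
theorem exists_straightening_of_involutive {Z : E → B →L[ℝ] E} {V : Set E}
    (hZ : ContDiffOn ℝ ∞ Z V) (hV : IsOpen V) {x₀ : E} (hx₀ : x₀ ∈ V)
    (hinj : Function.Injective (Z x₀))
    (hinv : ∀ x ∈ V, ∀ a b : B,
      fderiv ℝ Z x (Z x a) b - fderiv ℝ Z x (Z x b) a ∈ (Z x).range)
    (hdim : Module.finrank ℝ B + Module.finrank ℝ C = Module.finrank ℝ E) :
    ∃ φ : OpenPartialHomeomorph E (B × C), x₀ ∈ φ.source ∧ φ.source ⊆ V ∧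
      ContDiffOn ℝ ∞ φ φ.source ∧ ContDiffOn ℝ ∞ φ.symm φ.target ∧
      ∀ x ∈ φ.source, ∀ v, v ∈ (Z x).range ↔ (fderiv ℝ φ x v).2 = 0 := by
  have := FiniteDimensional.complete ℝ E
  have := FiniteDimensional.complete ℝ B
  obtain ⟨pr₀, hpr₀⟩ := LinearMap.exists_leftInverse_of_injective (Z x₀ : B →ₗ[ℝ] E)
    (LinearMap.ker_eq_bot.2 hinj)
  let pr : E →L[ℝ] B := pr₀.toContinuousLinearMap
  have hpr : ∀ b, pr (Z x₀ b) = b := fun b ↦ congr($hpr₀ b)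
  let A : E → B →L[ℝ] B := fun x ↦ pr.comp (Z x)
  have hA : ContDiffOn ℝ ∞ A V := contDiffOn_const.clm_comp hZ
  let V' : Set E := V ∩ A ⁻¹' Set.range ((↑) : (B ≃L[ℝ] B) → B →L[ℝ] B)
  have hV' : IsOpen V' :=
    hA.continuousOn.isOpen_inter_preimage hV (ContinuousLinearEquiv.isOpen)
  have hA₀ : A x₀ = ContinuousLinearMap.id ℝ B := by
    ext b
    exact hpr b
  have hx₀' : x₀ ∈ V' := ⟨hx₀, ContinuousLinearEquiv.refl ℝ B, hA₀.symm⟩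
  -- This frame has the same range as `Z` and satisfies `pr ∘ W = id`. Differentiating shows that
  -- `pr` kills its brackets; they also lie in the range of `W`, where `pr` is injective, so they
  -- vanish.
  let W : E → B →L[ℝ] E := fun x ↦ (Z x).comp (A x).inverse
  have hW : ContDiffOn ℝ ∞ W V' := by
    refine (hZ.mono Set.inter_subset_left).clm_comp fun x hx ↦ ?_
    obtain ⟨hxV, f, hf⟩ := hx
    have h1 : ContDiffAt ℝ ∞ ContinuousLinearMap.inverse (A x) := hf ▸ contDiffAt_map_inverse f
    exact (h1.comp x (hA.contDiffAt (hV.mem_nhds hxV))).contDiffWithinAt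
  have hWA : ∀ x ∈ V', (W x).comp (A x) = Z x := by
    rintro x ⟨-, f, hf⟩
    ext b
    simp [W, ← hf]
  have hprW : ∀ x ∈ V', pr.comp (W x) = ContinuousLinearMap.id ℝ B := by
    rintro x ⟨-, f, hf⟩
    have : pr.comp (W x) = (A x).comp (A x).inverse := rfl
    rw [this, ← hf]
    ext b
    simp
  have hrange : ∀ x ∈ V', (W x).range = (Z x).range := by
    intro x hx
    ext v
    constructor
    · rintro ⟨b, rfl⟩
      exact ⟨(A x).inverse b, rfl⟩
    · rintro ⟨b, rfl⟩
      exact ⟨A x b, congr($(hWA x hx) b)⟩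
  have hWd : ∀ x ∈ V', HasFDerivAt W (fderiv ℝ W x) x := fun x hx ↦
    ((hW.contDiffAt (hV'.mem_nhds hx)).differentiableAt (by simp)).hasFDerivAt
  have hAd : ∀ x ∈ V', HasFDerivAt A (fderiv ℝ A x) x := fun x hx ↦
    ((hA.contDiffAt (hV.mem_nhds hx.1)).differentiableAt (by simp)).hasFDerivAt
  have hZd : ∀ x ∈ V', ∀ u c, fderiv ℝ Z x u c =
      fderiv ℝ W x u (A x c) + W x (fderiv ℝ A x u c) := by
    intro x hx u c
    have h1 := (hWd x hx).clm_comp (hAd x hx)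
    have h2 := h1.congr_of_eventuallyEq (f₁ := Z) (by
      filter_upwards [hV'.mem_nhds hx] with y hy using (hWA y hy).symm)
    rw [h2.fderiv]
    simp [add_comm]
  have hprd : ∀ x ∈ V', ∀ u c, pr (fderiv ℝ W x u c) = 0 := by
    intro x hx u c
    have h1 := (hasFDerivAt_const pr x).clm_comp (hWd x hx)
    have h2 := h1.unique ((hasFDerivAt_const (ContinuousLinearMap.id ℝ B) x).congr_of_eventuallyEq
      (by filter_upwards [hV'.mem_nhds hx] with y hy using hprW y hy))
    simpa using congr($h2 u c)
  have hcomm : ∀ x ∈ V', ∀ a b : B, fderiv ℝ W x (W x a) b = fderiv ℝ W x (W x b) a := by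
    intro x hx a b
    have hAi : ∀ c, A x ((A x).inverse c) = c := fun c ↦ congr($(hprW x hx) c)
    have hWZ : ∀ c, Z x ((A x).inverse c) = W x c := fun c ↦ rfl
    have h1 := hinv x hx.1 ((A x).inverse a) ((A x).inverse b)
    rw [hZd x hx, hZd x hx, hAi, hAi, hWZ, hWZ, ← hrange x hx] at h1
    -- Replacing `Z` by `W` alters the bracket only by values of `W x`, from differentiating `A`, so
    -- involutivity survives.
    have h2 : fderiv ℝ W x (W x a) b - fderiv ℝ W x (W x b) a ∈ (W x).range := by
      have h3 := ((W x).range).sub_mem h1 (LinearMap.mem_range_self (W x : B →ₗ[ℝ] E)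
        (fderiv ℝ A x (W x a) ((A x).inverse b) - fderiv ℝ A x (W x b) ((A x).inverse a)))
      convert h3 using 1
      simp
      abel
    obtain ⟨c, hc⟩ := h2
    have h3 : pr (W x c) = c := congr($(hprW x hx) c)
    have h4 : pr (W x c) = 0 := by
      have : W x c = fderiv ℝ W x (W x a) b - fderiv ℝ W x (W x b) a := hc
      rw [this, map_sub, hprd x hx, hprd x hx, sub_zero]
    rw [h3] at h4
    subst h4
    rw [map_zero] at hc
    exact (sub_eq_zero.1 hc.symm)
  have hker : Module.finrank ℝ C = Module.finrank ℝ (LinearMap.ker pr₀) := by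
    have h1 := LinearMap.finrank_range_add_finrank_ker pr₀
    have h2 : LinearMap.range pr₀ = ⊤ := LinearMap.range_eq_top.2 fun b ↦ ⟨Z x₀ b, hpr b⟩
    rw [h2, finrank_top] at h1
    omega
  let κ : C ≃ₗ[ℝ] LinearMap.ker pr₀ := LinearEquiv.ofFinrankEq _ _ hker
  -- The transversal direction is `ker pr`, a complement of the range of `W x₀`.
  let ι : C →L[ℝ] E := ((LinearMap.ker pr₀).subtype ∘ₗ κ.toLinearMap).toContinuousLinearMap
  have hprι : ∀ c, pr (ι c) = 0 := fun c ↦ (κ c).2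
  let g₀ : B × C →ₗ[ℝ] E := (W x₀ : B →ₗ[ℝ] E).coprod (ι : C →ₗ[ℝ] E)
  have hg₀ : Function.Injective g₀ := by
    rw [← LinearMap.ker_eq_bot, LinearMap.ker_eq_bot']
    rintro ⟨b, c⟩ h
    have h' : W x₀ b + ι c = 0 := by simpa [g₀] using h
    have h1 : pr (W x₀ b) = b := congr($(hprW x₀ hx₀') b)
    have hb : b = 0 := by
      have := congr(pr $h')
      rwa [map_add, hprι, h1, add_zero, map_zero] at this
    rw [hb, map_zero, zero_add] at h'
    have hc : c = 0 := κ.injective (Subtype.ext (by simpa [ι] using h'))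
    rw [hb, hc]
    rfl
  let g : (B × C) ≃L[ℝ] E :=
    (LinearMap.linearEquivOfInjective g₀ hg₀ (by simp [hdim])).toContinuousLinearEquiv
  obtain ⟨φ, h1, h2, h3, h4, h5⟩ :=
    exists_straightening_of_commuting hW hV' hx₀' hcomm ι g fun w ↦ by simp [g, g₀]
  exact ⟨φ, h1, h2.trans Set.inter_subset_left, h3, h4, fun x hx v ↦
    hrange x (h2 hx) ▸ h5 x hx v⟩

end Frobenius

/-! ### Frobenius theorem for frames in coordinates -/

section Frames

open scoped Topology

/-- The linear isomorphism `ℝʳ × ℝᵐ ≃ ℝⁿ` that lists the coordinates, for `r + m = n`. -/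
theorem exists_coordinate_splitting {r m n : ℕ} (h : r + m = n) :
    ∃ κ : ((Fin r → ℝ) × (Fin m → ℝ)) ≃L[ℝ] EuclideanSpace ℝ (Fin n),
      ∀ w, (∀ i : Fin n, r ≤ (i : ℕ) → κ w i = 0) ↔ w.2 = 0 := by
  subst h
  let κ₀ : ((Fin r → ℝ) × (Fin m → ℝ)) ≃ₗ[ℝ] (Fin (r + m) → ℝ) :=
    { toFun := fun w ↦ Fin.append w.1 w.2
      invFun := fun v ↦ (fun i ↦ v (Fin.castAdd m i), fun i ↦ v (Fin.natAdd r i))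
      map_add' := fun w w' ↦ by
        ext i
        refine Fin.addCases (fun j ↦ ?_) (fun j ↦ ?_) i <;> simp
      map_smul' := fun c w ↦ by
        ext i
        refine Fin.addCases (fun j ↦ ?_) (fun j ↦ ?_) i <;> simp
      left_inv := fun w ↦ by ext i <;> simp
      right_inv := fun v ↦ by
        ext i
        refine Fin.addCases (fun j ↦ ?_) (fun j ↦ ?_) i <;> simp }
  refine ⟨κ₀.toContinuousLinearEquiv.trans
    (EuclideanSpace.equiv (Fin (r + m)) ℝ).symm, fun w ↦ ⟨fun hw ↦ ?_, fun hw i hi ↦ ?_⟩⟩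
  · ext j
    simpa [κ₀] using hw (Fin.natAdd r j) (by simp)
  · revert hi
    refine Fin.addCases (fun j hj ↦ ?_) (fun j hj ↦ ?_) i
    · exact absurd hj (by simp)
    · simp [κ₀, hw]

/-- **Local Frobenius theorem** for a frame of vector fields on an open subset of `ℝⁿ`. -/
theorem exists_straightening_of_frame {r n : ℕ} (hr : r ≤ n)
    {Z : Fin r → EuclideanSpace ℝ (Fin n) → EuclideanSpace ℝ (Fin n)}
    {V : Set (EuclideanSpace ℝ (Fin n))} (hZ : ∀ i, ContDiffOn ℝ ∞ (Z i) V) (hV : IsOpen V)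
    {x₀ : EuclideanSpace ℝ (Fin n)} (hx₀ : x₀ ∈ V) (hli : LinearIndependent ℝ fun i ↦ Z i x₀)
    (hinv : ∀ x ∈ V, ∀ i j,
      VectorField.lieBracket ℝ (Z i) (Z j) x ∈ Submodule.span ℝ (Set.range fun k ↦ Z k x)) :
    ∃ φ : OpenPartialHomeomorph (EuclideanSpace ℝ (Fin n)) (EuclideanSpace ℝ (Fin n)),
      x₀ ∈ φ.source ∧ φ.source ⊆ V ∧
      ContDiffOn ℝ ∞ φ φ.source ∧ ContDiffOn ℝ ∞ φ.symm φ.target ∧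
      ∀ x ∈ φ.source, ∀ v, v ∈ Submodule.span ℝ (Set.range fun k ↦ Z k x) ↔
        ∀ i : Fin n, r ≤ (i : ℕ) → fderiv ℝ φ x v i = 0 := by
  let P : Fin r → (Fin r → ℝ) →L[ℝ] ℝ := fun i ↦ ContinuousLinearMap.proj i
  let S : EuclideanSpace ℝ (Fin n) → (Fin r → ℝ) →L[ℝ] EuclideanSpace ℝ (Fin n) :=
    fun x ↦ ∑ i, (P i).smulRight (Z i x)
  have hSapp : ∀ x b, S x b = ∑ i, b i • Z i x := fun x b ↦ by
    simp [S, P]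
  let R : Fin r → EuclideanSpace ℝ (Fin n) →L[ℝ] (Fin r → ℝ) →L[ℝ] EuclideanSpace ℝ (Fin n) :=
    fun i ↦ ContinuousLinearMap.smulRightL ℝ _ _ (P i)
  have hS : ContDiffOn ℝ ∞ S V :=
    ContDiffOn.sum fun i _ ↦ (R i).contDiff.comp_contDiffOn (hZ i)
  have hSd : ∀ x ∈ V, ∀ u b, fderiv ℝ S x u b = ∑ i, b i • fderiv ℝ (Z i) x u := by
    intro x hx u b
    have h : HasFDerivAt S (∑ i, (R i).comp (fderiv ℝ (Z i) x)) x :=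
      HasFDerivAt.fun_sum fun i _ ↦ (R i).hasFDerivAt.comp x
        (((hZ i).contDiffAt (hV.mem_nhds hx)).differentiableAt (by simp)).hasFDerivAt
    rw [h.fderiv]
    simp [R, P]
  have hrange : ∀ x, (S x).range = Submodule.span ℝ (Set.range fun k ↦ Z k x) := by
    intro x
    ext v
    rw [Submodule.mem_span_range_iff_exists_fun]
    exact exists_congr fun b ↦ by
      rw [ContinuousLinearMap.coe_coe, hSapp]
  obtain ⟨κ, hκ⟩ := exists_coordinate_splitting (Nat.add_sub_cancel' hr)
  have hinj : Function.Injective (S x₀) := by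
    rw [injective_iff_map_eq_zero]
    intro b hb
    rw [hSapp] at hb
    ext i
    exact Fintype.linearIndependent_iff.1 hli b hb i
  have hinv' : ∀ x ∈ V, ∀ a b, fderiv ℝ S x (S x a) b - fderiv ℝ S x (S x b) a ∈ (S x).range := by
    intro x hx a b
    -- The coefficients `a`, `b` are constant, so the bracket expands bilinearly without derivative
    -- terms.
    have : fderiv ℝ S x (S x a) b - fderiv ℝ S x (S x b) a =
        ∑ i, ∑ j, (a i * b j) • VectorField.lieBracket ℝ (Z i) (Z j) x := by
      rw [hSd x hx, hSd x hx]
      simp only [hSapp, map_sum, map_smul, Finset.smul_sum, smul_smul, VectorField.lieBracket,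
        smul_sub, Finset.sum_sub_distrib]
      rw [Finset.sum_comm]
      congr 1
      exact Finset.sum_congr rfl fun i _ ↦ Finset.sum_congr rfl fun j _ ↦ by rw [mul_comm]
    rw [this, hrange]
    exact Submodule.sum_mem _ fun i _ ↦ Submodule.sum_mem _ fun j _ ↦
      Submodule.smul_mem _ _ (hinv x hx i j)
  obtain ⟨φ, h1, h2, h3, h4, h5⟩ := exists_straightening_of_involutive (C := Fin (n - r) → ℝ)
    hS hV hx₀ hinj hinv' (by simp [hr])
  refine ⟨φ.trans κ.toHomeomorph.toOpenPartialHomeomorph, by simpa using h1, by simpa using h2,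
    ?_, ?_, fun x hx v ↦ ?_⟩
  · simpa using κ.contDiff.comp_contDiffOn h3
  · have : ContDiffOn ℝ ∞ (φ.symm ∘ κ.symm) (κ.symm ⁻¹' φ.target) :=
      h4.comp κ.symm.contDiff.contDiffOn fun w hw ↦ hw
    simpa using! this
  · have hx' : x ∈ φ.source := by simpa using hx
    have hd : HasFDerivAt (φ.trans κ.toHomeomorph.toOpenPartialHomeomorph)
        ((κ : _ →L[ℝ] _).comp (fderiv ℝ φ x)) x :=
      κ.hasFDerivAt.comp x
        ((h3.contDiffAt (φ.open_source.mem_nhds hx')).differentiableAt (by simp)).hasFDerivAt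
    rw [hd.fderiv, ← hrange, h5 x hx' v, ← hκ]
    rfl

end Frames

/-! ### Flat charts, foliations and the Frobenius theorem on manifolds -/

section Charts

open scoped Topology

variable {r n : ℕ} {M : Type*} [TopologicalSpace M]
  [ChartedSpace (EuclideanSpace ℝ (Fin n)) M] [IsManifold (𝓡 n) ∞ M]

omit [IsManifold (𝓡 n) ∞ M] in
theorem mdifferentiable_of_mem_maximalAtlas {e : OpenPartialHomeomorph M (EuclideanSpace ℝ (Fin n))}
    (he : e ∈ IsManifold.maximalAtlas (𝓡 n) ∞ M) : e.MDifferentiable (𝓡 n) (𝓡 n) :=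
  ⟨(contMDiffOn_of_mem_maximalAtlas he).mdifferentiableOn (by simp),
    (contMDiffOn_symm_of_mem_maximalAtlas he).mdifferentiableOn (by simp)⟩

/-- The chart `e` is flat for `D`: on its domain, `D` is the common kernel of the differentials of
the last `n - r` coordinates. -/
def TangentDistribution.IsFlatChart (D : TangentDistribution r n M)
    (e : OpenPartialHomeomorph M (EuclideanSpace ℝ (Fin n))) : Prop :=
  ∀ x ∈ e.source, ∀ v : TangentSpace (𝓡 n) x,
    v ∈ D.fiber x ↔ ∀ i : Fin n, r ≤ (i : ℕ) → mvfderiv (𝓡 n) e x v i = 0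

omit [IsManifold (𝓡 n) ∞ M] in
/-- The derivative of a coordinate change. -/
theorem hasFDerivAt_coordChange {e e' : OpenPartialHomeomorph M (EuclideanSpace ℝ (Fin n))}
    (he : e ∈ IsManifold.maximalAtlas (𝓡 n) ∞ M) (he' : e' ∈ IsManifold.maximalAtlas (𝓡 n) ∞ M)
    {x : M} (hx : x ∈ e.source) (hx' : x ∈ e'.source) :
    ∃ L : EuclideanSpace ℝ (Fin n) →L[ℝ] EuclideanSpace ℝ (Fin n),
      HasFDerivAt (e.symm.trans e') L (e x) ∧
      ∀ v, L (mvfderiv (𝓡 n) e x v) = mvfderiv (𝓡 n) e' x v := by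
  have hd := mdifferentiable_of_mem_maximalAtlas he
  have hd' := mdifferentiable_of_mem_maximalAtlas he'
  have hex : e x ∈ (e.symm.trans e').source := by
    simp [hx, hx', e.map_source hx]
  have h1 := ((hd.symm.trans hd').mdifferentiableAt hex).hasMFDerivAt
  refine ⟨_, h1.hasFDerivAt, fun v ↦ ?_⟩
  have h2 := h1.comp x (hd.mdifferentiableAt hx).hasMFDerivAt
  have h3 : HasMFDerivAt (𝓡 n) (𝓡 n) e' x _ := h2.congr_of_eventuallyEq (by
    filter_upwards [e.open_source.mem_nhds hx] with y hy
    simp [e.left_inv hy])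
  have h4 := h3.mfderiv
  exact congr($h4 v).symm

/-- The derivative of the transition map preserves the vectors whose last `n - r` coordinates
vanish. On a ball, two points of one plaque are joined by a segment in such a direction, along which
the last coordinates of the image have zero derivative. -/
theorem TangentDistribution.IsFlatChart.foliatedCompatible {D : TangentDistribution r n M}
    {e e' : OpenPartialHomeomorph M (EuclideanSpace ℝ (Fin n))}
    (he : e ∈ IsManifold.maximalAtlas (𝓡 n) ∞ M) (he' : e' ∈ IsManifold.maximalAtlas (𝓡 n) ∞ M)
    (hD : D.IsFlatChart e) (hD' : D.IsFlatChart e') : FoliatedCompatible r e e' := by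
  intro z hz
  obtain ⟨ε, hε, hball⟩ := Metric.isOpen_iff.1 (e.symm.trans e').open_source z hz
  refine ⟨Metric.ball z ε, Metric.isOpen_ball, Metric.mem_ball_self hε, hball,
    fun w hw w' hw' hww' i hi ↦ ?_⟩
  have hseg : ∀ t ∈ Set.Icc (0 : ℝ) 1, w + t • (w' - w) ∈ Metric.ball z ε := fun t ht ↦
    (convex_ball z ε).add_smul_sub_mem hw hw' ht
  have hderiv : ∀ t ∈ Set.Icc (0 : ℝ) 1,
      HasDerivAt (fun t : ℝ ↦ (e.symm.trans e') (w + t • (w' - w)) i) 0 t := by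
    intro t ht
    have hu := hball (hseg t ht)
    set u := w + t • (w' - w)
    have hu1 : u ∈ e.target := by simpa using hu.1
    have hu2 : e.symm u ∈ e'.source := by simpa using hu.2
    obtain ⟨L, hL, hLv⟩ := hasFDerivAt_coordChange he he' (e.map_target hu1) hu2
    rw [e.right_inv hu1] at hL
    obtain ⟨v, hv⟩ := (mdifferentiable_of_mem_maximalAtlas he).mfderiv_surjective
      (e.map_target hu1) (w' - w)
    have hv' : mvfderiv (𝓡 n) e (e.symm u) v = w' - w := hv
    have hvD : v ∈ D.fiber (e.symm u) := (hD _ (e.map_target hu1) v).2 fun j hj ↦ by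
      rw [hv']
      simp [hww' j hj]
    have hLi : L (w' - w) i = 0 := by
      rw [← hv', hLv]
      exact (hD' _ hu2 v).1 hvD i hi
    have h1 : HasDerivAt (fun t : ℝ ↦ w + t • (w' - w)) (w' - w) t := by
      simpa using ((hasDerivAt_id t).smul_const (w' - w)).const_add w
    have h2 : HasDerivAt (fun t : ℝ ↦ (e.symm.trans e') (w + t • (w' - w)) i) (L (w' - w) i) t :=
      (EuclideanSpace.proj (𝕜 := ℝ) i).hasFDerivAt.comp_hasDerivAt t
        (HasFDerivAt.comp_hasDerivAt t hL h1)
    rwa [hLi] at h2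
  have hconst := constant_of_has_deriv_right_zero (a := (0 : ℝ)) (b := 1)
    (f := fun t : ℝ ↦ (e.symm.trans e') (w + t • (w' - w)) i)
    (fun t ht ↦ (hderiv t ht).continuousAt.continuousWithinAt)
    (fun t ht ↦ (hderiv t ⟨ht.1, ht.2.le⟩).hasDerivWithinAt) 1 (by simp)
  simpa using hconst.symm

/-- Differentiating the foliated form along a plaque direction places `D` inside the kernel defined
by `e`. Both are preimages of one coordinate subspace under isomorphisms, so equal dimension gives
equality, and compatibility in one direction is enough. -/
theorem TangentDistribution.IsFlatChart.of_foliatedCompatible {D : TangentDistribution r n M}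
    {e : OpenPartialHomeomorph M (EuclideanSpace ℝ (Fin n))}
    (he : e ∈ IsManifold.maximalAtlas (𝓡 n) ∞ M)
    (h : ∀ x : M, ∃ e' ∈ IsManifold.maximalAtlas (𝓡 n) ∞ M, x ∈ e'.source ∧ D.IsFlatChart e' ∧
      FoliatedCompatible r e' e) : D.IsFlatChart e := by
  intro x hx
  obtain ⟨e', he', hx', hD', hcomp⟩ := h x
  have hex : e' x ∈ (e'.symm.trans e).source := by simp [hx, hx', e'.map_source hx']
  let S : Submodule ℝ (EuclideanSpace ℝ (Fin n)) :=
    ⨅ i : {i : Fin n // r ≤ (i : ℕ)}, LinearMap.ker (EuclideanSpace.proj (𝕜 := ℝ) i.1).toLinearMap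
  have hS : ∀ w, w ∈ S ↔ ∀ i : Fin n, r ≤ (i : ℕ) → w i = 0 := fun w ↦ by
    simp [S, Submodule.mem_iInf]
  let A : TangentSpace (𝓡 n) x ≃L[ℝ] EuclideanSpace ℝ (Fin n) :=
    (mdifferentiable_of_mem_maximalAtlas he).mfderiv hx
  let A' : TangentSpace (𝓡 n) x ≃L[ℝ] EuclideanSpace ℝ (Fin n) :=
    (mdifferentiable_of_mem_maximalAtlas he').mfderiv hx'
  have hDA' : D.fiber x = S.comap A'.toLinearEquiv.toLinearMap := by
    ext v
    rw [hD' x hx' v, Submodule.mem_comap, hS]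
    rfl
  have hle : D.fiber x ≤ S.comap A.toLinearEquiv.toLinearMap := by
    intro v hv
    rw [Submodule.mem_comap, hS]
    intro i hi
    obtain ⟨W, hWo, hzW, -, hW⟩ := hcomp (e' x) hex
    obtain ⟨L, hL, hLv⟩ := hasFDerivAt_coordChange he' he hx' hx
    have hw := (hD' x hx' v).1 hv
    set w := mvfderiv (𝓡 n) e' x v
    have h1 : HasDerivAt (fun t : ℝ ↦ e' x + t • w) w 0 := by
      simpa using ((hasDerivAt_id (0 : ℝ)).smul_const w).const_add (e' x)
    have h2 : HasDerivAt (fun t : ℝ ↦ (e'.symm.trans e) (e' x + t • w) i) (L w i) 0 :=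
      (EuclideanSpace.proj (𝕜 := ℝ) i).hasFDerivAt.comp_hasDerivAt (0 : ℝ)
        (HasFDerivAt.comp_hasDerivAt (0 : ℝ) (by simpa using hL) h1)
    have h3 : HasDerivAt (fun t : ℝ ↦ (e'.symm.trans e) (e' x + t • w) i) 0 0 := by
      refine (hasDerivAt_const (0 : ℝ) ((e'.symm.trans e) (e' x) i)).congr_of_eventuallyEq ?_
      have : (fun t : ℝ ↦ e' x + t • w) ⁻¹' W ∈ 𝓝 0 :=
        h1.continuousAt.preimage_mem_nhds (by simpa using hWo.mem_nhds hzW)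
      filter_upwards [this] with t ht
      exact hW _ ht _ hzW (fun j hj ↦ by simp [hw j hj]) i hi
    have h4 : A v = L w := (hLv v).symm
    change (A v) i = 0
    rw [h4]
    exact h2.unique h3
  have hfin : FiniteDimensional ℝ (TangentSpace (𝓡 n) x) :=
    inferInstanceAs (FiniteDimensional ℝ (EuclideanSpace ℝ (Fin n)))
  have heq : D.fiber x = S.comap A.toLinearEquiv.toLinearMap := by
    refine Submodule.eq_of_le_of_finrank_eq hle ?_
    rw [hDA']
    exact ((A'.toLinearEquiv.ofSubmodule' S).finrank_eq).trans
      (A.toLinearEquiv.ofSubmodule' S).finrank_eq.symm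
  intro v
  rw [heq, Submodule.mem_comap, hS]
  rfl

/-- Flat charts are mutually compatible, so maximality forces every flat chart into `F`. Thus `D`
determines the whole atlas, which is the uniqueness claim. -/
theorem Foliation.isTangentTo_iff {F : Foliation r n M} {D : TangentDistribution r n M} :
    F.IsTangentTo D ↔ F.charts = {e ∈ IsManifold.maximalAtlas (𝓡 n) ∞ M | D.IsFlatChart e} := by
  refine ⟨fun h ↦ ?_, fun h e he ↦ ?_⟩
  · ext e
    refine ⟨fun he ↦ ⟨F.charts_subset he, h e he⟩, fun he ↦ F.maximal e he.1 fun e' he' ↦ ?_⟩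
    exact ⟨he.2.foliatedCompatible he.1 (F.charts_subset he') (h e' he'),
      TangentDistribution.IsFlatChart.foliatedCompatible (F.charts_subset he') he.1 (h e' he')
        he.2⟩
  · rw [h] at he
    exact he.2

theorem Foliation.charts_injective :
    Function.Injective (Foliation.charts : Foliation r n M → _) := by
  rintro ⟨_, _, _, _, _, _⟩ ⟨_, _, _, _, _, _⟩ h
  cases h
  rfl

theorem TangentDistribution.existsUnique_foliation {D : TangentDistribution r n M} (hr : r ≤ n)
    (h : ∀ x : M, ∃ e ∈ IsManifold.maximalAtlas (𝓡 n) ∞ M, x ∈ e.source ∧ D.IsFlatChart e) :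
    ∃! F : Foliation r n M, F.IsTangentTo D := by
  let F : Foliation r n M :=
    { dim_le := hr
      charts := {e ∈ IsManifold.maximalAtlas (𝓡 n) ∞ M | D.IsFlatChart e}
      charts_subset := fun e he ↦ he.1
      covers := fun x ↦ by
        obtain ⟨e, he, hx, hD⟩ := h x
        exact ⟨e, ⟨he, hD⟩, hx⟩
      compatible := fun e he e' he' ↦ he.2.foliatedCompatible he.1 he'.1 he'.2
      maximal := fun e he hcomp ↦ ⟨he, .of_foliatedCompatible he fun x ↦ by
        obtain ⟨e', he', hx, hD⟩ := h x
        exact ⟨e', he', hx, hD, (hcomp e' ⟨he', hD⟩).2⟩⟩ }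
  refine ⟨F, Foliation.isTangentTo_iff.2 rfl, fun F' hF' ↦ Foliation.charts_injective ?_⟩
  exact Foliation.isTangentTo_iff.1 hF'

theorem TangentDistribution.isInvolutive_of_isParallel {D : TangentDistribution r n M}
    {nabla : CovariantDerivative (𝓡 n) (EuclideanSpace ℝ (Fin n))
      (TangentSpace (𝓡 n) : M → Type _)}
    (htorsion : nabla.torsion = 0) (hD : D.IsParallel nabla) : D.IsInvolutive := by
  intro X Y hX hY
  have heq : VectorField.mlieBracket (𝓡 n) X Y =
      (fun x ↦ nabla Y x (X x)) - fun x ↦ nabla X x (Y x) := by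
    ext1 x
    exact (nabla.torsion_eq_zero_iff.1 htorsion (hX.1.mdifferentiableAt (by simp)) (hY.1.mdifferentiableAt (by simp))).symm
  have h1 := hD X Y hX.1 hY
  have h2 := hD Y X hY.1 hX
  rw [heq]
  exact ⟨h1.1.sub_section h2.1, fun x ↦ (D.fiber x).sub_mem (h1.2 x) (h2.2 x)⟩

theorem LinearEquiv.mem_span_range_symm_iff {ι E F : Type*} [AddCommGroup E] [Module ℝ E]
    [AddCommGroup F] [Module ℝ F] (A : E ≃ₗ[ℝ] F) (y : ι → F) (w : E) :
    w ∈ Submodule.span ℝ (Set.range fun i ↦ A.symm (y i)) ↔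
      A w ∈ Submodule.span ℝ (Set.range y) := by
  have : (Set.range fun i ↦ A.symm (y i)) = (A.symm : F →ₗ[ℝ] E) '' Set.range y := by
    rw [← Set.range_comp]
    rfl
  rw [this, ← Submodule.map_span, Submodule.map_equiv_eq_comap_symm]
  simp

/-- **Frobenius theorem**: an involutive distribution has flat charts around every point. -/
theorem TangentDistribution.IsInvolutive.exists_isFlatChart [T2Space M]
    {D : TangentDistribution r n M} (hr : r ≤ n) (hD : D.IsInvolutive) (x₀ : M) :
    ∃ e ∈ IsManifold.maximalAtlas (𝓡 n) ∞ M, x₀ ∈ e.source ∧ D.IsFlatChart e := by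
  obtain ⟨U, hU, hxU, X, hX, hspan⟩ := D.exists_local_frame x₀
  -- Involutivity concerns global sections, so the local frame is cut off by a bump function; it is
  -- unchanged near `x₀`.
  obtain ⟨χ, hχU, -⟩ := ((SmoothBumpFunction.nhds_basis_support (I := 𝓡 n)
    (hU.mem_nhds hxU)).mem_iff).1 (hU.mem_nhds hxU)
  let Y : Fin r → Π y : M, TangentSpace (𝓡 n) y := fun i ↦ (χ : M → ℝ) • X i
  have hY : ∀ i, D.IsSection (Y i) := fun i ↦ by
    refine ⟨ContMDiffOn.smul_section_of_tsupport χ.contMDiff.contMDiffOn hU hχU (hX i),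
      fun y ↦ ?_⟩
    by_cases hy : y ∈ U
    · exact Submodule.smul_mem _ _ (hspan y hy ▸ Submodule.subset_span ⟨i, rfl⟩)
    · have : χ y = 0 := image_eq_zero_of_notMem_tsupport fun h ↦ hy (hχU h)
      simp [Y, this]
  obtain ⟨U', hU'1, hU', hxU'⟩ := eventually_nhds_iff.1
    (χ.eventuallyEq_one.and (hU.mem_nhds hxU))
  have hYspan : ∀ y ∈ U', Submodule.span ℝ (Set.range fun i ↦ Y i y) = D.fiber y := by
    intro y hy
    rw [← hspan y (hU'1 y hy).2]
    congr! 3 with i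
    have : χ y = 1 := (hU'1 y hy).1
    simp [Y, this]
  let c := chartAt (EuclideanSpace ℝ (Fin n)) x₀
  have hc : c ∈ IsManifold.maximalAtlas (𝓡 n) ∞ M := IsManifold.chart_mem_maximalAtlas x₀
  have hxc : x₀ ∈ c.source := mem_chart_source _ x₀
  have hcd := mdifferentiable_of_mem_maximalAtlas hc
  let A : ∀ {z}, z ∈ c.target → (EuclideanSpace ℝ (Fin n) ≃L[ℝ] TangentSpace (𝓡 n) (c.symm z)) :=
    fun hz ↦ hcd.symm.mfderiv hz
  let Z : Fin r → EuclideanSpace ℝ (Fin n) → EuclideanSpace ℝ (Fin n) :=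
    fun i ↦ VectorField.mpullback (𝓡 n) (𝓡 n) c.symm (Y i)
  have hpull : ∀ {z} (hz : z ∈ c.target) (V : Π y : M, TangentSpace (𝓡 n) y),
      VectorField.mpullback (𝓡 n) (𝓡 n) c.symm V z = (A hz).symm (V (c.symm z)) := by
    intro z hz V
    have : mfderiv (𝓡 n) (𝓡 n) c.symm z = ((hcd.symm.mfderiv hz :
        TangentSpace (𝓡 n) z ≃L[ℝ] TangentSpace (𝓡 n) (c.symm z)) :
          TangentSpace (𝓡 n) z →L[ℝ] TangentSpace (𝓡 n) (c.symm z)) := rfl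
    rw [VectorField.mpullback_apply, this, ContinuousLinearMap.inverse_equiv]
    rfl
  have hcs : ∀ z ∈ c.target, ContMDiffAt (𝓡 n) (𝓡 n) ∞ c.symm z := fun z hz ↦
    contMDiffAt_symm_of_mem_maximalAtlas hc hz
  let V : Set (EuclideanSpace ℝ (Fin n)) := c.target ∩ c.symm ⁻¹' U'
  have hV : IsOpen V := c.isOpen_inter_preimage_symm hU'
  have hZ : ∀ i, ContDiffOn ℝ ∞ (Z i) V := fun i z hz ↦ by
    have hinv : (mfderiv (𝓡 n) (𝓡 n) c.symm z).IsInvertible := ⟨hcd.symm.mfderiv hz.1, rfl⟩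
    refine ContDiffAt.contDiffWithinAt (contMDiffAt_vectorSpace_iff_contDiffAt.1 ?_)
    exact ContMDiffAt.mpullback_vectorField_preimage (n := ∞) ((hY i).1 _) (hcs z hz.1)
      hinv (by simp)
  have hZspan : ∀ z ∈ V, ∀ w : EuclideanSpace ℝ (Fin n),
      w ∈ Submodule.span ℝ (Set.range fun i ↦ Z i z) ↔
        mfderiv (𝓡 n) (𝓡 n) c.symm z w ∈ D.fiber (c.symm z) := by
    intro z hz w
    have h := (A hz.1).toLinearEquiv.mem_span_range_symm_iff (fun i ↦ Y i (c.symm z)) w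
    rw [hYspan _ hz.2] at h
    have h1 : (fun i ↦ Z i z) = fun i ↦ (A hz.1).toLinearEquiv.symm (Y i (c.symm z)) :=
      funext fun i ↦ hpull hz.1 (Y i)
    rw [h1]
    exact h
  have : IsManifold (𝓡 n) (minSmoothness ℝ 2) M := by
    rw [minSmoothness_of_isRCLikeNormedField]
    infer_instance
  have hbracket : ∀ z ∈ V, ∀ i j,
      VectorField.lieBracket ℝ (Z i) (Z j) z ∈ Submodule.span ℝ (Set.range fun k ↦ Z k z) := by
    intro z hz i j
    -- Brackets commute with pullback by the chart, which transfers involutivity of `D` to the frame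
    -- `Z` on `ℝⁿ`.
    have h1 : VectorField.mpullback (𝓡 n) (𝓡 n) c.symm
        (VectorField.mlieBracket (𝓡 n) (Y i) (Y j)) z =
          VectorField.mlieBracket (𝓡 n) (Z i) (Z j) z :=
      VectorField.mpullback_mlieBracket (n := ∞)
        ((hY i).1.mdifferentiableAt (by simp)) ((hY j).1.mdifferentiableAt (by simp))
        (hcs z hz.1) (by simpa using ENat.LEInfty.out)
    have h2 : VectorField.mlieBracket (𝓡 n) (Z i) (Z j) z =
        VectorField.lieBracket ℝ (Z i) (Z j) z := by
      have := congrFun (VectorField.mlieBracketWithin_eq_lieBracketWithin (𝕜 := ℝ)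
        (V := Z i) (W := Z j) (s := Set.univ)) z
      rwa [VectorField.lieBracketWithin_univ] at this
    refine (hZspan z hz _).2 ?_
    rw [← h2, ← h1, hpull hz.1]
    have h3 := (A hz.1).apply_symm_apply
      (VectorField.mlieBracket (𝓡 n) (Y i) (Y j) (c.symm z))
    have h4 := (hD _ _ (hY i) (hY j)).2 (c.symm z)
    rw [← h3] at h4
    exact h4
  have hx₀V : c x₀ ∈ V := ⟨c.map_source hxc, by simpa [c.left_inv hxc] using hxU'⟩
  have hli : LinearIndependent ℝ fun i ↦ Z i (c x₀) := by
    have h1 : LinearIndependent ℝ fun i ↦ Y i (c.symm (c x₀)) := by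
      rw [linearIndependent_iff_card_eq_finrank_span, Set.finrank, hYspan _ hx₀V.2,
        D.finrank_fiber, Fintype.card_fin]
    have h2 : (fun i ↦ Z i (c x₀)) =
        (A hx₀V.1).symm.toLinearEquiv.toLinearMap ∘ fun i ↦ Y i (c.symm (c x₀)) :=
      funext fun i ↦ hpull hx₀V.1 (Y i)
    have h3 := h1.map' (A hx₀V.1).symm.toLinearEquiv.toLinearMap (LinearEquiv.ker _)
    rw [h2]
    exact h3
  obtain ⟨φ, h1, h2, h3, h4, h5⟩ := exists_straightening_of_frame hr hZ hV hx₀V hli hbracket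
  refine ⟨c.trans φ, ?_, by simp [hxc, h1], fun x hx v ↦ ?_⟩
  · refine OpenPartialHomeomorph.mem_maximalAtlas_of_contMDiffOn _ ?_ ?_
    · exact h3.contMDiffOn.comp ((contMDiffOn_of_mem_maximalAtlas hc).mono (by simp))
        (fun x hx ↦ by simpa using hx.2)
    · exact (contMDiffOn_symm_of_mem_maximalAtlas hc).comp (h4.contMDiffOn.mono (by simp))
        (fun x hx ↦ by simpa using hx.2)
  · have hxc' : x ∈ c.source := hx.1
    have hxφ : c x ∈ φ.source := hx.2
    have hz := h2 hxφ
    have hd : HasMFDerivAt (𝓡 n) (𝓡 n) (c.trans φ) x _ :=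
      HasMFDerivAt.comp (g := φ) (f := c) x ((h3.contDiffAt
        (φ.open_source.mem_nhds hxφ)).differentiableAt (by simp)).hasFDerivAt.hasMFDerivAt
        (hcd.mdifferentiableAt hxc').hasMFDerivAt
    let w : EuclideanSpace ℝ (Fin n) := mfderiv (𝓡 n) (𝓡 n) c x v
    have hmv : mvfderiv (𝓡 n) (c.trans φ) x v = fderiv ℝ φ (c x) w := congr($(hd.mfderiv) v)
    -- `c.symm (c x)` equals `x` only propositionally, so membership in the fiber has to be
    -- transported between the two tangent spaces.
    have key : ∀ y (u : TangentSpace (𝓡 n) y), y = x → (u : EuclideanSpace ℝ (Fin n)) = v →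
        (v ∈ D.fiber x ↔ u ∈ D.fiber y) := by
      rintro _ u rfl rfl
      rfl
    rw [hmv]
    exact (key _ _ (c.left_inv hxc') congr($(hcd.symm_comp_deriv hxc') v)).trans
      ((hZspan _ hz w).symm.trans (h5 _ hxφ w))

end Charts

theorem proposition3p1 {p q r n : ℕ} {M : Type*} [TopologicalSpace M] [T2Space M]
    [SecondCountableTopology M] [ChartedSpace (EuclideanSpace ℝ (Fin n)) M]
    [IsManifold (𝓡 n) ∞ M]
    (g : PseudoRiemannianMetric p q n M)
    (nabla : CovariantDerivative (𝓡 n) (EuclideanSpace ℝ (Fin n))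
      (TangentSpace (𝓡 n) : M → Type _))
    (hnabla : g.IsLeviCivita nabla)
    (D : TangentDistribution r n M) (hr : 2 * r ≤ n)
    (hparallel : D.IsParallel nabla) (hnull : D.IsTotallyIsotropic g) :
    D.IsInvolutive ∧ ∃! F : Foliation r n M, F.IsTangentTo D := by
  have hD : D.IsInvolutive :=
    TangentDistribution.isInvolutive_of_isParallel hnabla.torsion_free hparallel
  have hrn : r ≤ n := by omega
  exact ⟨hD, D.existsUnique_foliation hrn (hD.exists_isFlatChart hrn)⟩
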